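/- **Theorem (Rotation uniformizes coordinate variances).** Let $D\ge 1$, let $Q$ be a Haar-distributed random matrix in the orthogonal group $O(D)$, and let $q_i^\top$ denote its $i$-th row. Let $\operatorname{sign}(t)\in\{-1,0,1\}$ be the sign of $t$, applied to vectors coordinatewise. (a) $\operatorname{sign}(Qx)$ is a random-hyperplane locality-sensitive hash: for every $i\in\{1,\dots,D\}$, the coordinate hash $h_i(x)=\operatorname{sign}(Qx)_i$ is of the form $h_i(x)=\operatorname{sign}\langle r,x\rangle$ with a random vector $r$ (the normal of the hyperplane) uniformly distributed on the unit sphere $\mathbb S^{D-1}$, and for all nonzero $x,y\in\mathbb R^D$, with $\cos(x,y)=\langle x,y\rangle/(\|x\|\,\|y\|)$, $$P[h_i(x)=h_i(y)]=1-\frac{\arccos(\cos(x,y))}{\pi}.$$ (b) For every $c>0$ there is a constant $C>0$, depending only on $c$, such that for every $D\ge1$, every Haar-random $Q\in O(D)$ and every covariance (i.e. symmetric positive semidefinite) matrix $\Sigma\in\mathbb R^{D\times D}$, with probability at least $1-D^{-c}$, $$\max_{1\le i\le D}\left|q_i^\top\Sigma q_i-\frac{\operatorname{tr}(\Sigma)}{D}\right|\le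 C\,\|\Sigma\|_{\mathrm{op}}\sqrt{\frac{\log D}{D}}.$$ -/

import Mathlib

open MeasureTheory ProbabilityTheory
open scoped Matrix RealInnerProductSpace

noncomputable section

/-- The uniform probability measure on the unit sphere of `ℝ^D` (normalized surface measure),
regarded as a measure on `ℝ^D`. -/
def uniformSphere (D : ℕ) : Measure (EuclideanSpace ℝ (Fin D)) :=
  (((volume : Measure (EuclideanSpace ℝ (Fin D))).toSphere Set.univ)⁻¹ •
    (volume : Measure (EuclideanSpace ℝ (Fin D))).toSphere).map Subtype.val

/-- A random hash function `h` on `ℝ^D` is a random-hyperplane hash if `h(x)` records on which side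
of the hyperplane `r^⊥` the point `x` lies, with `r` uniformly distributed on the unit sphere. -/
def IsRandomHyperplaneHash {Ω : Type*} [MeasurableSpace Ω] {D : ℕ}
    (h : Ω → EuclideanSpace ℝ (Fin D) → SignType) (P : Measure Ω) : Prop :=
  ∃ r : Ω → EuclideanSpace ℝ (Fin D), HasLaw r (uniformSphere D) P ∧
    ∀ ω x, h ω x = SignType.sign ⟪r ω, x⟫

/-- The coordinatewise sign vector `sign(Ax)`. -/
def signHash {D : ℕ} (A : Matrix (Fin D) (Fin D) ℝ) (x : EuclideanSpace ℝ (Fin D)) :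
    Fin D → SignType :=
  fun i => SignType.sign ((A *ᵥ x.ofLp) i)

/-- The cosine similarity `⟨x, y⟩ / (‖x‖ ‖y‖)`. -/
def cosSim {D : ℕ} (x y : EuclideanSpace ℝ (Fin D)) : ℝ :=
  ⟪x, y⟫ / (‖x‖ * ‖y‖)

/-- The Borel σ-algebra on `O(D)` (whose topology is the one inherited from matrices). -/
instance orthogonalGroupMeasurableSpace (D : ℕ) :
    MeasurableSpace (Matrix.orthogonalGroup (Fin D) ℝ) :=
  borel _

instance orthogonalGroupBorelSpace (D : ℕ) : BorelSpace (Matrix.orthogonalGroup (Fin D) ℝ) :=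
  ⟨rfl⟩

/-- `Q` is a Haar-random orthogonal matrix: its law is a Haar measure on the compact group `O(D)`.
(The law is a probability measure whenever `P` is one.) -/
def IsHaarRandom {Ω : Type*} [MeasurableSpace Ω] {D : ℕ}
    (Q : Ω → Matrix.orthogonalGroup (Fin D) ℝ) (P : Measure Ω) : Prop :=
  AEMeasurable Q P ∧ (P.map Q).IsHaarMeasure

/-- The operator norm of a matrix acting on Euclidean space. -/
def opNorm {D : ℕ} (S : Matrix (Fin D) (Fin D) ℝ) : ℝ :=
  ‖Matrix.toEuclideanCLM (𝕜 := ℝ) S‖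

/-- The `i`-th coordinate variance after rotation, `q_i^⊤ S q_i`, where `q_i^⊤` is the `i`-th row
of `A`. -/
def rotatedVariance {D : ℕ} (A S : Matrix (Fin D) (Fin D) ℝ) (i : Fin D) : ℝ :=
  A.row i ⬝ᵥ (S *ᵥ A.row i)

end

/-! ### Gaussian quadratic forms -/

/-! Everything reduces to one row of `Q`, and one row reduces to a Gaussian vector. If `ρ` is any
rotation-invariant probability measure on the sphere, then averaging `F (x U)` over Haar `U` and
over `x ∼ ρ` in either order (Fubini) shows that a row has law `ρ` (`map_orthogonalRow_eq`). This
applies both to normalized surface measure, which gives the law in (a), and to `g / ‖g‖` with `g`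
standard Gaussian, which is the model used for computations.

For (a), the sign event ignores the length of `g`, and the law of `(⟪x, g⟫, ⟪y, g⟫)` depends only on
the Gram matrix of `x, y`. So the problem lives in the plane, where a cone has Gaussian measure
proportional to its angle; the signs disagree on a double wedge of total angle `2θ`, where `θ` is
the angle between `x` and `y`.

For (b), diagonalize `Σ`. After multiplication by `‖g‖²` the deviation event is homogeneous: `∑ (λᵢ
- m - t) gᵢ² > 0` with `m` the mean eigenvalue, and similarly for the other sign. A Chernoff bound
with independent `gᵢ` handles it directly, so no separate concentration of `‖g‖` is needed. A union
bound over the rows finishes. -/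

theorem inv_sqrt_one_sub_le_exp {u : ℝ} (hu : |u| ≤ 1 / 2) :
    (√(1 - u))⁻¹ ≤ Real.exp ((u + u ^ 2) / 2) := by
  obtain ⟨h1, h2⟩ := abs_le.1 hu
  have hpos : 0 < 1 - u := by linarith
  have key : 1 ≤ (1 - u) * Real.exp (u + u ^ 2) := by
    -- The first-order bound on `exp` yields `1 - u³`, enough only for `u ≤ 0`; for `u ≥ 0` the
    -- quadratic term is needed to absorb `-u³`.
    rcases le_total u 0 with h | h
    · have := Real.add_one_le_exp (u + u ^ 2)
      have h3 : (1 - u) * (u + u ^ 2 + 1) ≤ (1 - u) * Real.exp (u + u ^ 2) := by gcongr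
      nlinarith [mul_nonneg (sq_nonneg u) (neg_nonneg.2 h)]
    · have := Real.quadratic_le_exp_of_nonneg (x := u + u ^ 2) (by positivity)
      have h3 : (1 - u) * (1 + (u + u ^ 2) + (u + u ^ 2) ^ 2 / 2) ≤
          (1 - u) * Real.exp (u + u ^ 2) := by gcongr
      have h4 : 0 ≤ (1 - u) * (1 + u) ^ 2 / 2 - u := by
        nlinarith [mul_nonneg h (sub_nonneg.2 h2), mul_nonneg (mul_nonneg h h) (sub_nonneg.2 h2)]
      nlinarith [mul_nonneg (sq_nonneg u) h4]
  rw [Real.exp_half, ← Real.sqrt_inv]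
  refine Real.sqrt_le_sqrt ?_
  rwa [inv_le_iff_one_le_mul₀' hpos]

theorem integral_exp_mul_sq_gaussianReal {v : ℝ} (hv : 2 * v < 1) :
    ∫ x, Real.exp (v * x ^ 2) ∂(gaussianReal 0 1) = (√(1 - 2 * v))⁻¹ := by
  rw [integral_gaussianReal_eq_integral_smul (by simp)]
  have : ∀ x : ℝ, gaussianPDFReal 0 1 x • Real.exp (v * x ^ 2) =
      (√(2 * Real.pi))⁻¹ * Real.exp (-(1 / 2 - v) * x ^ 2) := by
    intro x
    simp only [gaussianPDFReal, smul_eq_mul, NNReal.coe_one, mul_one, sub_zero, mul_assoc]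
    rw [← Real.exp_add]
    ring_nf
  simp_rw [this]
  have h : 0 < 1 - 2 * v := by linarith
  rw [integral_const_mul, integral_gaussian, ← Real.sqrt_inv, ← Real.sqrt_inv,
    ← Real.sqrt_mul (by positivity)]
  congr 1
  have : 1 / 2 - v ≠ 0 := by linarith
  have := Real.pi_ne_zero
  field_simp

theorem integrable_exp_mul_sq_gaussianReal {v : ℝ} (hv : 2 * v < 1) :
    Integrable (fun x => Real.exp (v * x ^ 2)) (gaussianReal 0 1) := by
  -- A non-integrable function has integral `0` by convention, whereas the closed form is positive.
  refine not_imp_comm.1 integral_undef ?_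
  rw [integral_exp_mul_sq_gaussianReal hv]
  have : 0 < 1 - 2 * v := by linarith
  positivity

/-- Chernoff bound for the event `∑ (wᵢ - t) xᵢ² > 0`: the exponential moment factors over
coordinates, and `∑ wᵢ = 0` kills the first-order contribution of the weights. -/
theorem pi_gaussian_weighted_sum_tail {ι : Type*} [Fintype ι] (w : ι → ℝ) {s t : ℝ}
    (hw : ∑ i, w i = 0) (hs : ∀ i, |w i| ≤ s) (ht : 0 < t) (hts : t ≤ s) :
    (Measure.pi fun _ : ι => gaussianReal 0 1).real
      {x | t * ∑ i, x i ^ 2 < ∑ i, w i * x i ^ 2} ≤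
      Real.exp (-(Fintype.card ι * t ^ 2 / (16 * s ^ 2))) := by
  have hspos : 0 < s := ht.trans_le hts
  -- Minimizer of the per-coordinate exponent `4 l² s² - l t`, with value `-t² / (16 s²)`. Since `t
  -- ≤ s`, it also keeps `2 l |wᵢ - t| ≤ 1/2`.
  set l : ℝ := t / (8 * s ^ 2) with hl
  have hlpos : 0 < l := by positivity
  have hu : ∀ i, |2 * (l * (w i - t))| ≤ 1 / 2 := by
    intro i
    have h1 : |w i - t| ≤ 2 * s := by
      obtain ⟨h1, h2⟩ := abs_le.1 (hs i)
      rw [abs_le]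
      constructor <;> linarith
    rw [abs_mul, abs_mul, abs_of_pos hlpos, abs_two]
    calc 2 * (l * |w i - t|) ≤ 2 * (l * (2 * s)) := by gcongr
      _ = t / (2 * s) := by rw [hl]; field_simp; ring
      _ ≤ 1 / 2 := by rw [div_le_div_iff₀ (by positivity) (by positivity)]; linarith
  have hu1 : ∀ i, 2 * (l * (w i - t)) < 1 := fun i => by linarith [(abs_le.1 (hu i)).2]
  set f : (ι → ℝ) → ℝ := fun x => ∏ i, Real.exp (l * (w i - t) * x i ^ 2) with hf
  have hint : Integrable f (Measure.pi fun _ : ι => gaussianReal 0 1) :=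
    Integrable.fintype_prod (f := fun i y => Real.exp (l * (w i - t) * y ^ 2))
      fun i => integrable_exp_mul_sq_gaussianReal (hu1 i)
  have hmarkov := mul_meas_ge_le_integral_of_nonneg
    (ae_of_all _ fun x => Finset.prod_nonneg fun i _ => (Real.exp_pos _).le) hint 1
  rw [one_mul] at hmarkov
  have hsub : {x : ι → ℝ | t * ∑ i, x i ^ 2 < ∑ i, w i * x i ^ 2} ⊆ {x | 1 ≤ f x} := by
    intro x hx
    simp only [Set.mem_ofPred_eq, hf, ← Real.exp_sum, Real.one_le_exp_iff] at hx ⊢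
    have : ∑ i, l * (w i - t) * x i ^ 2 = l * (∑ i, w i * x i ^ 2 - t * ∑ i, x i ^ 2) := by
      rw [Finset.mul_sum, ← Finset.sum_sub_distrib, Finset.mul_sum]
      exact Finset.sum_congr rfl fun i _ => by ring
    rw [this]
    exact mul_nonneg hlpos.le (sub_nonneg.2 hx.le)
  refine (measureReal_mono hsub).trans (hmarkov.trans ?_)
  rw [integral_fintype_prod_eq_prod (f := fun i y => Real.exp (l * (w i - t) * y ^ 2))]
  calc ∏ i, ∫ y, Real.exp (l * (w i - t) * y ^ 2) ∂(gaussianReal 0 1)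
      ≤ ∏ i, Real.exp ((2 * (l * (w i - t)) + (2 * (l * (w i - t))) ^ 2) / 2) := by
        refine Finset.prod_le_prod (fun i _ => integral_nonneg fun y => (Real.exp_pos _).le)
          fun i _ => ?_
        rw [integral_exp_mul_sq_gaussianReal (hu1 i)]
        exact inv_sqrt_one_sub_le_exp (hu i)
    _ = Real.exp (∑ i, (2 * (l * (w i - t)) + (2 * (l * (w i - t))) ^ 2) / 2) :=
        (Real.exp_sum _ _).symm
    _ ≤ _ := by
        rw [Real.exp_le_exp]
        calc ∑ i, (2 * (l * (w i - t)) + (2 * (l * (w i - t))) ^ 2) / 2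
            ≤ ∑ i, ((l - 4 * l ^ 2 * t) * w i + (4 * l ^ 2 * s ^ 2 - l * t)) := by
              refine Finset.sum_le_sum fun i _ => ?_
              have h1 : w i ^ 2 ≤ s ^ 2 := sq_le_sq' (abs_le.1 (hs i)).1 (abs_le.1 (hs i)).2
              have h2 : t ^ 2 ≤ s ^ 2 := by gcongr
              nlinarith [mul_le_mul_of_nonneg_left h1 (sq_nonneg l),
                mul_le_mul_of_nonneg_left h2 (sq_nonneg l)]
          _ = -(Fintype.card ι * t ^ 2 / (16 * s ^ 2)) := by
              rw [Finset.sum_add_distrib, ← Finset.mul_sum, hw, Finset.sum_const, Finset.card_univ,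
                hl, nsmul_eq_mul]
              field_simp
              ring

/-! ### Spectral reduction of quadratic forms to weighted sums of squares -/

section Quadratic

variable {D : ℕ} {S : Matrix (Fin D) (Fin D) ℝ}

theorem dotProduct_mulVec_eq_sum_eigenvalues (hS : S.IsHermitian)
    (g : EuclideanSpace ℝ (Fin D)) :
    g.ofLp ⬝ᵥ (S *ᵥ g.ofLp) = ∑ i, hS.eigenvalues i * ⟪hS.eigenvectorBasis i, g⟫ ^ 2 := by
  have hST : Sᵀ = S := by rwa [Matrix.IsHermitian, Matrix.conjTranspose_eq_transpose_of_trivial] at hS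
  have h1 : g.ofLp ⬝ᵥ (S *ᵥ g.ofLp) = ⟪g, WithLp.toLp 2 (S *ᵥ g.ofLp)⟫ := by
    rw [EuclideanSpace.inner_eq_star_dotProduct, dotProduct_comm]
    simp
  rw [h1, ← OrthonormalBasis.sum_inner_mul_inner hS.eigenvectorBasis]
  refine Finset.sum_congr rfl fun i _ => ?_
  have h2 : ⟪hS.eigenvectorBasis i, WithLp.toLp 2 (S *ᵥ g.ofLp)⟫ =
      hS.eigenvalues i * ⟪hS.eigenvectorBasis i, g⟫ := by
    have := hS.mulVec_eigenvectorBasis i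
    simp only [EuclideanSpace.inner_eq_star_dotProduct, star_trivial] at this ⊢
    rw [dotProduct_comm, Matrix.dotProduct_mulVec, ← Matrix.mulVec_transpose, hST, this,
      smul_dotProduct, smul_eq_mul, dotProduct_comm]
  rw [h2, real_inner_comm g]
  ring

theorem eigenvalues_le_opNorm (hS : S.IsHermitian) (i : Fin D) :
    |hS.eigenvalues i| ≤ opNorm S := by
  have h := (Matrix.toEuclideanCLM (𝕜 := ℝ) S).le_opNorm (hS.eigenvectorBasis i)
  have h2 : Matrix.toEuclideanCLM (𝕜 := ℝ) S (hS.eigenvectorBasis i) =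
      hS.eigenvalues i • hS.eigenvectorBasis i := by
    apply (WithLp.ofLp_injective 2)
    rw [Matrix.ofLp_toEuclideanCLM, hS.mulVec_eigenvectorBasis i]
    rfl
  rw [h2, norm_smul, OrthonormalBasis.norm_eq_one, mul_one, mul_one] at h
  exact h

theorem trace_div_mem_Icc (hS : S.PosSemidef) :
    S.trace / D ∈ Set.Icc 0 (opNorm S) := by
  have h0 : 0 ≤ opNorm S := norm_nonneg _
  have htr : S.trace = ∑ i, hS.1.eigenvalues i := by
    simpa using hS.1.trace_eq_sum_eigenvalues
  constructor
  · exact div_nonneg (htr ▸ Finset.sum_nonneg fun i _ => hS.eigenvalues_nonneg i) (by positivity)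
  · refine div_le_of_le_mul₀ (by positivity) h0 ?_
    rw [htr]
    refine (Finset.sum_le_card_nsmul _ _ (opNorm S)
      fun i _ => (le_abs_self _).trans (eigenvalues_le_opNorm hS.1 i)).trans_eq ?_
    simp [mul_comm]

theorem dotProduct_mulVec_mem_Icc (hS : S.PosSemidef) {g : EuclideanSpace ℝ (Fin D)}
    (hg : ‖g‖ = 1) : g.ofLp ⬝ᵥ (S *ᵥ g.ofLp) ∈ Set.Icc 0 (opNorm S) := by
  rw [dotProduct_mulVec_eq_sum_eigenvalues hS.1]
  constructor
  · exact Finset.sum_nonneg fun i _ => mul_nonneg (hS.eigenvalues_nonneg i) (sq_nonneg _)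
  · calc _ ≤ ∑ i, opNorm S * ⟪hS.1.eigenvectorBasis i, g⟫ ^ 2 := by
          gcongr with i
          exact (le_abs_self _).trans (eigenvalues_le_opNorm hS.1 i)
      _ = opNorm S := by
          rw [← Finset.mul_sum, OrthonormalBasis.sum_sq_inner_right, hg, one_pow, mul_one]

/-- Gaussian coordinates are independent in every orthonormal basis, in particular in an eigenbasis
of `S`. -/
theorem map_inner_stdGaussian {ι E : Type*} [Fintype ι] [NormedAddCommGroup E]
    [InnerProductSpace ℝ E] [FiniteDimensional ℝ E] [MeasurableSpace E] [BorelSpace E]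
    (b : OrthonormalBasis ι ℝ E) :
    (stdGaussian E).map (fun g i => ⟪b i, g⟫) = Measure.pi fun _ => gaussianReal 0 1 := by
  rw [stdGaussian_eq_map_pi_orthonormalBasis b, Measure.map_map (by fun_prop) (by fun_prop)]
  convert Measure.map_id
  ext x i
  classical
  simp [inner_sum, inner_smul_right, b.inner_eq_ite]

theorem stdGaussian_quadratic_tail (hS : S.PosSemidef) {t : ℝ} (ht : 0 < t)
    (hts : t ≤ opNorm S) :
    (stdGaussian (EuclideanSpace ℝ (Fin D))).real
      {g | t * ‖g‖ ^ 2 < |g.ofLp ⬝ᵥ (S *ᵥ g.ofLp) - S.trace / D * ‖g‖ ^ 2|} ≤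
      2 * Real.exp (-(D * t ^ 2 / (16 * opNorm S ^ 2))) := by
  rcases Nat.eq_zero_or_pos D with rfl | hD
  · exact measureReal_le_one.trans (by simp)
  have hD' : (D : ℝ) ≠ 0 := by positivity
  set b := hS.1.eigenvectorBasis
  set m := S.trace / D with hm
  obtain ⟨hm0, hm1⟩ := trace_div_mem_Icc hS
  -- Centering makes the weights sum to zero. Positivity of `S` puts the eigenvalues and `m` in `[0,
  -- opNorm S]`, so `|wᵢ| ≤ opNorm S`. The two tails come from `w` and `-w`.
  set w : Fin D → ℝ := fun i => hS.1.eigenvalues i - m with hw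
  have htr : S.trace = ∑ i, hS.1.eigenvalues i := by
    simpa using hS.1.trace_eq_sum_eigenvalues
  have hsum : ∑ i, w i = 0 := by
    simp only [hw, Finset.sum_sub_distrib, ← htr, Finset.sum_const, Finset.card_univ,
      Fintype.card_fin, nsmul_eq_mul, hm]
    field_simp
    ring
  have hws : ∀ i, |w i| ≤ opNorm S := by
    intro i
    have h1 := hS.eigenvalues_nonneg i
    have h2 := (le_abs_self _).trans (eigenvalues_le_opNorm hS.1 i)
    rw [abs_le]
    constructor <;> simp only [hw] <;> linarith
  have h1 := pi_gaussian_weighted_sum_tail w hsum hws ht hts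
  have h2 := pi_gaussian_weighted_sum_tail (fun i => -w i) (by simp [hsum])
    (by simpa using hws) ht hts
  rw [Fintype.card_fin] at h1 h2
  set X : EuclideanSpace ℝ (Fin D) → Fin D → ℝ := fun g i => ⟪b i, g⟫
  have hX : Measurable X := by fun_prop
  have hmeas : ∀ v : Fin D → ℝ,
      MeasurableSet {x : Fin D → ℝ | t * ∑ i, x i ^ 2 < ∑ i, v i * x i ^ 2} :=
    fun v => measurableSet_lt (by fun_prop) (by fun_prop)
  rw [← map_inner_stdGaussian b, map_measureReal_apply hX (hmeas _)] at h1 h2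
  rw [two_mul]
  refine (measureReal_mono ?_).trans ((measureReal_union_le _ _).trans (add_le_add h1 h2))
  intro g hg
  have hn : ∑ i, X g i ^ 2 = ‖g‖ ^ 2 := b.sum_sq_inner_right g
  have hq : g.ofLp ⬝ᵥ (S *ᵥ g.ofLp) - m * ‖g‖ ^ 2 = ∑ i, w i * X g i ^ 2 := by
    rw [dotProduct_mulVec_eq_sum_eigenvalues hS.1, ← hn, Finset.mul_sum, ← Finset.sum_sub_distrib]
    exact Finset.sum_congr rfl fun i _ => by simp only [hw]; ring
  rw [Set.mem_ofPred_eq, hq, lt_abs] at hg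
  rcases hg with hg | hg
  · left
    simpa [hn] using hg
  · right
    simpa [hn] using hg

end Quadratic

/-! ### Uniqueness of rotation-invariant measures on the sphere -/

section Invariance

variable {D : ℕ}

/-- Right multiplication of row vectors by an orthogonal matrix. -/
noncomputable def orthogonalVecMul (U : Matrix.orthogonalGroup (Fin D) ℝ) :
    EuclideanSpace ℝ (Fin D) ≃ₗᵢ[ℝ] EuclideanSpace ℝ (Fin D) :=
  LinearIsometry.toLinearIsometryEquiv
    { toFun := fun x => WithLp.toLp 2 (x.ofLp ᵥ* U.1)
      map_add' := fun x y => by simp [Matrix.add_vecMul]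
      map_smul' := fun c x => by simp [Matrix.smul_vecMul]
      norm_map' := fun x => by
        have h : U.1 * U.1ᵀ = 1 := (Matrix.mem_orthogonalGroup_iff _ _).1 U.2
        rw [← sq_eq_sq₀ (norm_nonneg _) (norm_nonneg _)]
        simp only [← real_inner_self_eq_norm_sq, LinearMap.coe_mk, AddHom.coe_mk,
          EuclideanSpace.inner_eq_star_dotProduct, star_trivial]
        rw [← Matrix.dotProduct_mulVec, ← Matrix.mulVec_transpose U.1, Matrix.mulVec_mulVec, h,
          Matrix.one_mulVec] } rfl

theorem orthogonalVecMul_apply (U : Matrix.orthogonalGroup (Fin D) ℝ)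
    (x : EuclideanSpace ℝ (Fin D)) : orthogonalVecMul U x = WithLp.toLp 2 (x.ofLp ᵥ* U.1) := rfl

/-- The `i`-th row of an orthogonal matrix, as a vector of Euclidean space. -/
noncomputable def orthogonalRow (i : Fin D) (U : Matrix.orthogonalGroup (Fin D) ℝ) :
    EuclideanSpace ℝ (Fin D) :=
  WithLp.toLp 2 (U.1.row i)

theorem orthogonalRow_mul (i : Fin D) (U V : Matrix.orthogonalGroup (Fin D) ℝ) :
    orthogonalRow i (U * V) = orthogonalVecMul V (orthogonalRow i U) := by
  simp only [orthogonalRow, orthogonalVecMul_apply]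
  congr 1

theorem norm_orthogonalRow (i : Fin D) (U : Matrix.orthogonalGroup (Fin D) ℝ) :
    ‖orthogonalRow i U‖ = 1 := by
  have h : U.1 * U.1ᵀ = 1 := (Matrix.mem_orthogonalGroup_iff _ _).1 U.2
  have h2 := congrFun (congrFun h i) i
  rw [← sq_eq_sq₀ (norm_nonneg _) zero_le_one, ← real_inner_self_eq_norm_sq,
    EuclideanSpace.inner_eq_star_dotProduct]
  simpa [orthogonalRow, Matrix.mul_apply, dotProduct] using h2

theorem continuous_orthogonalRow (i : Fin D) : Continuous (orthogonalRow (D := D) i) := by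
  unfold orthogonalRow
  refine (PiLp.continuous_toLp 2 _).comp ?_
  exact (continuous_apply i).comp continuous_subtype_val

theorem exists_orthogonalRow_eq (i : Fin D) {x : EuclideanSpace ℝ (Fin D)} (hx : ‖x‖ = 1) :
    ∃ W : Matrix.orthogonalGroup (Fin D) ℝ, orthogonalRow i W = x := by
  let e := EuclideanSpace.basisFun (Fin D) ℝ
  -- The reflection in the hyperplane orthogonal to `e i - x` sends `e i` to `x`. Its matrix carries
  -- the images as columns, hence the transpose below.
  let f : EuclideanSpace ℝ (Fin D) ≃ₗᵢ[ℝ] EuclideanSpace ℝ (Fin D) :=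
    (Submodule.span ℝ {e i - x})ᗮ.reflection
  have hf : f (e i) = x := Submodule.reflection_sub (by simp [hx, e])
  refine ⟨⟨(e.toBasis.toMatrix (e.map f))ᵀ, ?_⟩, ?_⟩
  · rw [Matrix.mem_orthogonalGroup_iff]
    have := e.toMatrix_orthonormalBasis_mem_orthogonal (e.map f)
    rw [Matrix.mem_orthogonalGroup_iff'] at this
    simpa using this
  · ext j
    rw [← hf]
    simp [orthogonalRow, Module.Basis.toMatrix_apply, e]

instance : SecondCountableTopology (Matrix.orthogonalGroup (Fin D) ℝ) :=
  haveI : SecondCountableTopology (Matrix (Fin D) (Fin D) ℝ) :=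
    inferInstanceAs (SecondCountableTopology (Fin D → Fin D → ℝ))
  TopologicalSpace.Subtype.secondCountableTopology _

theorem measurable_orthogonalVecMul :
    Measurable fun p : Matrix.orthogonalGroup (Fin D) ℝ × EuclideanSpace ℝ (Fin D) =>
      orthogonalVecMul p.1 p.2 := by
  refine Continuous.measurable ?_
  simp only [orthogonalVecMul_apply]
  refine (PiLp.continuous_toLp 2 _).comp ?_
  exact Continuous.matrix_vecMul ((PiLp.continuous_ofLp 2 _).comp continuous_snd)
    (continuous_subtype_val.comp continuous_fst)

/-- A row of a Haar-random orthogonal matrix follows the only rotation-invariant probability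
measure on the unit sphere. -/
theorem map_orthogonalRow_eq (μ : Measure (Matrix.orthogonalGroup (Fin D) ℝ))
    [IsProbabilityMeasure μ] [μ.IsMulLeftInvariant] (i : Fin D)
    (ρ : Measure (EuclideanSpace ℝ (Fin D))) [IsProbabilityMeasure ρ]
    (hρ : ∀ᵐ x ∂ρ, ‖x‖ = 1)
    (hinv : ∀ f : EuclideanSpace ℝ (Fin D) ≃ₗᵢ[ℝ] EuclideanSpace ℝ (Fin D), ρ.map f = ρ) :
    μ.map (orthogonalRow i) = ρ := by
  have hrow := (continuous_orthogonalRow (D := D) i).measurable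
  ext s hs
  set F : EuclideanSpace ℝ (Fin D) → ENNReal := s.indicator 1
  have hF : Measurable F := measurable_one.indicator hs
  calc μ.map (orthogonalRow i) s = ∫⁻ U, F (orthogonalRow i U) ∂μ := by
        rw [← lintegral_map hF hrow, lintegral_indicator_one hs]
    _ = ∫⁻ _x, (∫⁻ U, F (orthogonalRow i U) ∂μ) ∂ρ := by simp
    -- A unit vector `x` is row `i` of some orthogonal `W`, so `x U` is row `i` of `W U`, and left
    -- invariance of `μ` removes `W`.
    _ = ∫⁻ x, (∫⁻ U, F (orthogonalVecMul U x) ∂μ) ∂ρ := by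
        refine lintegral_congr_ae ?_
        filter_upwards [hρ] with x hx
        obtain ⟨W, rfl⟩ := exists_orthogonalRow_eq i hx
        simp_rw [← orthogonalRow_mul]
        exact (lintegral_mul_left_eq_self (fun U => F (orthogonalRow i U)) W).symm
    _ = ∫⁻ U, (∫⁻ x, F (orthogonalVecMul U x) ∂ρ) ∂μ :=
        (lintegral_lintegral_swap (f := fun U x => F (orthogonalVecMul U x))
          (hF.comp measurable_orthogonalVecMul).aemeasurable).symm
    _ = ∫⁻ _U, ρ s ∂μ := by
        refine lintegral_congr fun U => ?_
        rw [← lintegral_map hF (orthogonalVecMul U).continuous.measurable, hinv,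
          lintegral_indicator_one hs]
    _ = ρ s := by simp

/-! ### Two rotation-invariant probability measures on the sphere -/

theorem isProbabilityMeasure_uniformSphere (hD : 0 < D) :
    IsProbabilityMeasure (uniformSphere D) := by
  have : Nonempty (Fin D) := ⟨⟨0, hD⟩⟩
  have : IsProbabilityMeasure
      (((volume : Measure (EuclideanSpace ℝ (Fin D))).toSphere Set.univ)⁻¹ •
        (volume : Measure (EuclideanSpace ℝ (Fin D))).toSphere) := by
    constructor
    rw [Measure.smul_apply, smul_eq_mul]
    exact ENNReal.inv_mul_cancel 
      (Measure.measure_univ_ne_zero.2 (Measure.toSphere_ne_zero _)) (measure_ne_top _ _)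
  exact Measure.isProbabilityMeasure_map (by fun_prop)

theorem ae_norm_uniformSphere : ∀ᵐ x ∂(uniformSphere D), ‖x‖ = 1 := by
  rw [uniformSphere, ae_map_iff (by fun_prop) (measurableSet_eq_fun (by fun_prop) (by fun_prop))]
  exact ae_of_all _ fun x => by simp

-- Surface measure of a set is, up to a constant, the volume of the cone over it in the unit ball; a
-- linear isometry carries cones to cones and preserves volume.
open scoped Pointwise in
theorem map_uniformSphere (f : EuclideanSpace ℝ (Fin D) ≃ₗᵢ[ℝ] EuclideanSpace ℝ (Fin D)) :
    (uniformSphere D).map f = uniformSphere D := by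
  have hf := f.continuous.measurable
  ext s hs
  rw [Measure.map_apply hf hs, uniformSphere, Measure.map_apply (by fun_prop) (hf hs),
    Measure.map_apply (by fun_prop) hs, Measure.smul_apply, Measure.smul_apply,
    Measure.toSphere_apply' _ (measurable_subtype_coe (hf hs)),
    Measure.toSphere_apply' _ (measurable_subtype_coe hs)]
  congr 2
  rw [← f.measurePreserving.measure_preimage_emb f.toHomeomorph.measurableEmbedding
    (Set.Ioo 0 1 • (Subtype.val '' (Subtype.val ⁻¹' s)))]
  congr 1
  ext x
  simp only [Set.mem_preimage, Set.mem_smul, Set.mem_image, Subtype.exists]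
  constructor
  · rintro ⟨r, hr, y, ⟨z, hz, hzs, rfl⟩, rfl⟩
    exact ⟨r, hr, f z, ⟨f z, by simpa using hz, hzs, rfl⟩, by simp⟩
  · rintro ⟨r, hr, y, ⟨z, hz, hzs, rfl⟩, hx⟩
    refine ⟨r, hr, f.symm z, ⟨f.symm z, by simpa using hz, by simpa using hzs, rfl⟩, ?_⟩
    rw [← map_smul, hx, f.symm_apply_apply]

/-- The standard Gaussian measure projected radially onto the unit sphere. -/
noncomputable def gaussianSphere (D : ℕ) : Measure (EuclideanSpace ℝ (Fin D)) :=
  (stdGaussian (EuclideanSpace ℝ (Fin D))).map fun g => ‖g‖⁻¹ • g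

instance : IsProbabilityMeasure (gaussianSphere D) :=
  Measure.isProbabilityMeasure_map (by fun_prop)

theorem map_gaussianSphere (f : EuclideanSpace ℝ (Fin D) ≃ₗᵢ[ℝ] EuclideanSpace ℝ (Fin D)) :
    (gaussianSphere D).map f = gaussianSphere D := by
  have hf := f.continuous.measurable
  rw [gaussianSphere, Measure.map_map hf (by fun_prop)]
  conv_rhs => rw [← stdGaussian_map f]
  rw [Measure.map_map (by fun_prop) hf]
  congr 1
  ext1 g
  simp

theorem ae_inner_ne_zero_stdGaussian {E : Type*} [NormedAddCommGroup E] [InnerProductSpace ℝ E]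
    [FiniteDimensional ℝ E] [MeasurableSpace E] [BorelSpace E] {x : E} (hx : x ≠ 0) :
    ∀ᵐ g ∂(stdGaussian E), ⟪x, g⟫ ≠ 0 := by
  have h := IsGaussian.map_eq_gaussianReal (μ := stdGaussian E) (innerSL ℝ x)
  rw [variance_dual_stdGaussian] at h
  have hv : (‖innerSL ℝ x‖ ^ 2).toNNReal ≠ 0 := by
    simpa using hx
  have := nullSingletonClass_gaussianReal (μ := (stdGaussian E)[innerSL ℝ x]) hv
  have h0 : ∀ᵐ y ∂((stdGaussian E).map (innerSL ℝ x)), y ≠ 0 := by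
    rw [h]
    exact Measure.ae_ne _ _
  exact ae_of_ae_map (f := innerSL ℝ x) (by fun_prop) h0

theorem ae_ne_zero_stdGaussian (hD : 0 < D) :
    ∀ᵐ g ∂(stdGaussian (EuclideanSpace ℝ (Fin D))), g ≠ 0 := by
  have hx : EuclideanSpace.single (⟨0, hD⟩ : Fin D) (1 : ℝ) ≠ 0 := by simp
  filter_upwards [ae_inner_ne_zero_stdGaussian hx] with g hg h
  simp [h] at hg

theorem ae_norm_gaussianSphere (hD : 0 < D) : ∀ᵐ x ∂(gaussianSphere D), ‖x‖ = 1 := by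
  rw [gaussianSphere, ae_map_iff (by fun_prop) (measurableSet_eq_fun (by fun_prop) (by fun_prop))]
  filter_upwards [ae_ne_zero_stdGaussian hD] with g hg
  simp [norm_smul, hg]

end Invariance

/-! ### Angles and Gaussian vectors -/

section Angle

variable {E F : Type*} [NormedAddCommGroup E] [InnerProductSpace ℝ E] [FiniteDimensional ℝ E]
  [MeasurableSpace E] [BorelSpace E] [NormedAddCommGroup F] [InnerProductSpace ℝ F]
  [FiniteDimensional ℝ F] [MeasurableSpace F] [BorelSpace F]

/-- A functional of the pair is the inner product with `a x + b y`, so the characteristic function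
is `exp (-‖a x + b y‖² / 2)`, which sees only the Gram matrix. -/
theorem charFunDual_map_inner_pair_stdGaussian (x y : E) (L : StrongDual ℝ (ℝ × ℝ)) :
    charFunDual ((stdGaussian E).map fun g => (⟪x, g⟫, ⟪y, g⟫)) L =
      Complex.exp (-((L (1, 0) ^ 2 * ‖x‖ ^ 2 + 2 * (L (1, 0) * L (0, 1) * ⟪x, y⟫) +
        L (0, 1) ^ 2 * ‖y‖ ^ 2 : ℝ) : ℂ) / 2) := by
  have h : charFunDual ((stdGaussian E).map ((innerSL ℝ x).prod (innerSL ℝ y))) L = _ :=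
    charFunDual_map _ L
  refine h.trans ?_
  have hL : L.comp ((innerSL ℝ x).prod (innerSL ℝ y)) =
      innerSL ℝ (L (1, 0) • x + L (0, 1) • y) := by
    ext g
    have : ((⟪x, g⟫, ⟪y, g⟫) : ℝ × ℝ) = ⟪x, g⟫ • (1, 0) + ⟪y, g⟫ • (0, 1) := by simp
    simp only [ContinuousLinearMap.comp_apply, ContinuousLinearMap.prod_apply, innerSL_apply_apply,
      inner_add_left, real_inner_smul_left]
    rw [this, map_add, map_smul, map_smul, smul_eq_mul, smul_eq_mul]
    ring
  rw [charFunDual_stdGaussian, hL, innerSL_apply_norm, ← Complex.ofReal_pow, norm_add_sq_real,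
    norm_smul, norm_smul, mul_pow, mul_pow, real_inner_smul_left, real_inner_smul_right,
    Real.norm_eq_abs, Real.norm_eq_abs, sq_abs, sq_abs, mul_assoc (L (1, 0))]

theorem map_inner_pair_stdGaussian_congr {x y : E} {x' y' : F} (hx : ‖x‖ = ‖x'‖)
    (hy : ‖y‖ = ‖y'‖) (hxy : ⟪x, y⟫ = ⟪x', y'⟫) :
    (stdGaussian E).map (fun g => (⟪x, g⟫, ⟪y, g⟫)) =
      (stdGaussian F).map fun g => (⟪x', g⟫, ⟪y', g⟫) := by
  have := Measure.isProbabilityMeasure_map (μ := stdGaussian E)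
    (f := fun g => (⟪x, g⟫, ⟪y, g⟫)) (by fun_prop)
  have := Measure.isProbabilityMeasure_map (μ := stdGaussian F)
    (f := fun g => (⟪x', g⟫, ⟪y', g⟫)) (by fun_prop)
  refine Measure.ext_of_charFunDual (funext fun L => ?_)
  rw [charFunDual_map_inner_pair_stdGaussian, charFunDual_map_inner_pair_stdGaussian, hx, hy, hxy]

theorem map_coords_stdGaussian_two :
    (stdGaussian (EuclideanSpace ℝ (Fin 2))).map (fun g => (g 0, g 1)) =
      (gaussianReal 0 1).prod (gaussianReal 0 1) := by
  have h := (measurePreserving_piFinTwo fun _ => gaussianReal 0 1).map_eq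
  rw [← h, ← map_inner_stdGaussian (EuclideanSpace.basisFun (Fin 2) ℝ),
    Measure.map_map (by fun_prop) (by fun_prop)]
  congr 1
  ext1 g
  simp [PiLp.inner_apply]

/-! ### Gaussian measure of planar cones via polar coordinates -/

theorem gaussian_prod_eq_withDensity :
    (gaussianReal 0 1).prod (gaussianReal 0 1) =
      (volume : Measure (ℝ × ℝ)).withDensity
        fun p => ENNReal.ofReal ((2 * Real.pi)⁻¹ * Real.exp (-(p.1 ^ 2 + p.2 ^ 2) / 2)) := by
  rw [gaussianReal_of_var_ne_zero _ one_ne_zero, prod_withDensity (by fun_prop) (by fun_prop),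
    Measure.volume_eq_prod]
  congr 1
  ext1 p
  rw [gaussianPDF, gaussianPDF, ← ENNReal.ofReal_mul (gaussianPDFReal_nonneg _ _ _)]
  congr 1
  simp only [gaussianPDFReal, NNReal.coe_one, mul_one, sub_zero]
  rw [mul_mul_mul_comm, ← Real.exp_add, ← mul_inv, Real.mul_self_sqrt (by positivity)]
  ring_nf

theorem gaussian_prod_cone_eq_mul {s : Set (ℝ × ℝ)} (hs : MeasurableSet s)
    (hcone : ∀ r : ℝ, 0 < r → ∀ p, r • p ∈ s ↔ p ∈ s) :
    ((gaussianReal 0 1).prod (gaussianReal 0 1)) s =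
      (∫⁻ r in Set.Ioi (0 : ℝ),
        ENNReal.ofReal r * ENNReal.ofReal ((2 * Real.pi)⁻¹ * Real.exp (-r ^ 2 / 2))) *
      volume (Set.Ioo (-Real.pi) Real.pi ∩ {φ | (Real.cos φ, Real.sin φ) ∈ s}) := by
  have hcs : MeasurableSet {φ : ℝ | (Real.cos φ, Real.sin φ) ∈ s} :=
    (by fun_prop : Measurable fun φ : ℝ => (Real.cos φ, Real.sin φ)) hs
  rw [gaussian_prod_eq_withDensity, withDensity_apply _ hs, ← lintegral_indicator hs,
    ← lintegral_comp_polarCoord_symm, polarCoord_target, Measure.volume_eq_prod,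
    ← Measure.prod_restrict]
  rw [Set.inter_comm, ← Measure.restrict_apply hcs, ← lintegral_indicator_one hcs,
    ← lintegral_prod_mul (by fun_prop) (measurable_one.indicator hcs).aemeasurable]
  rw [Measure.prod_restrict]
  refine setLIntegral_congr_fun (measurableSet_Ioi.prod measurableSet_Ioo) fun p hp => ?_
  have hmem : polarCoord.symm p ∈ s ↔ (Real.cos p.2, Real.sin p.2) ∈ s := by
    rw [polarCoord_symm_apply, ← hcone p.1 hp.1 (Real.cos p.2, Real.sin p.2)]
    simp
  by_cases h : (Real.cos p.2, Real.sin p.2) ∈ s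
  · have h2 : p.2 ∈ {φ : ℝ | (Real.cos φ, Real.sin φ) ∈ s} := h
    rw [Set.indicator_of_mem (hmem.2 h), Set.indicator_of_mem h2, polarCoord_symm_apply]
    simp only [smul_eq_mul, Pi.one_apply, mul_one]
    congr 4
    have := Real.sin_sq_add_cos_sq p.2
    linear_combination (-p.1 ^ 2) * this / 2
  · have h2 : p.2 ∉ {φ : ℝ | (Real.cos φ, Real.sin φ) ∈ s} := h
    rw [Set.indicator_of_notMem (mt hmem.1 h), Set.indicator_of_notMem h2]
    simp

theorem gaussian_prod_real_cone {s : Set (ℝ × ℝ)} (hs : MeasurableSet s)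
    (hcone : ∀ r : ℝ, 0 < r → ∀ p, r • p ∈ s ↔ p ∈ s) :
    ((gaussianReal 0 1).prod (gaussianReal 0 1)).real s =
      volume.real (Set.Ioo (-Real.pi) Real.pi ∩ {φ | (Real.cos φ, Real.sin φ) ∈ s}) /
        (2 * Real.pi) := by
  -- Applying the product formula to the whole plane determines the radial factor as `1 / (2π)`
  -- without evaluating the integral.
  have h1 := congrArg ENNReal.toReal (gaussian_prod_cone_eq_mul MeasurableSet.univ (by simp))
  have h2 := congrArg ENNReal.toReal (gaussian_prod_cone_eq_mul hs hcone)
  rw [ENNReal.toReal_mul] at h1 h2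
  rw [Measure.real, h2, ← Measure.real]
  have h3 : volume.real (Set.Ioo (-Real.pi) Real.pi) = 2 * Real.pi := by
    rw [Real.volume_real_Ioo_of_le (by linarith [Real.pi_pos])]
    ring
  simp only [Set.mem_univ, Set.ofPred_true, Set.inter_univ, measure_univ, ENNReal.toReal_one] at h1
  rw [← Measure.real, h3] at h1
  have := Real.pi_ne_zero
  rw [eq_div_iff (by positivity)]
  linear_combination (-volume.real (Set.Ioo (-Real.pi) Real.pi ∩
    {φ | (Real.cos φ, Real.sin φ) ∈ s})) * h1

theorem sign_eq_sign_iff {a b : ℝ} :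
    SignType.sign a = SignType.sign b ↔ (0 < a ∧ 0 < b) ∨ (a < 0 ∧ b < 0) ∨ (a = 0 ∧ b = 0) := by
  rcases lt_trichotomy a 0 with h | h | h <;> rcases lt_trichotomy b 0 with h' | h' | h' <;>
    simp [sign_pos, sign_neg, h, h', le_of_lt, ne_of_lt, ne_of_gt]

theorem measurableSet_sign_eq_sign {α : Type*} [MeasurableSpace α] {f g : α → ℝ}
    (hf : Measurable f) (hg : Measurable g) :
    MeasurableSet {a | SignType.sign (f a) = SignType.sign (g a)} := by
  simp only [sign_eq_sign_iff]
  exact ((measurableSet_lt measurable_const hf).inter (measurableSet_lt measurable_const hg)).union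
    (((measurableSet_lt hf measurable_const).inter (measurableSet_lt hg measurable_const)).union
      ((measurableSet_eq_fun hf measurable_const).inter (measurableSet_eq_fun hg measurable_const)))

theorem sign_mul_of_pos {r : ℝ} (hr : 0 < r) (a : ℝ) :
    SignType.sign (r * a) = SignType.sign a := by
  rw [sign_mul, sign_pos hr, one_mul]

theorem sign_cos_ne_sign_cos_iff {α φ : ℝ} (hα : α ∈ Set.Icc 0 (Real.pi / 2))
    (hφ : φ ∈ Set.Ioo (-Real.pi) Real.pi) (h1 : |φ| ≠ Real.pi / 2 - α)
    (h2 : |φ| ≠ Real.pi / 2 + α) :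
    SignType.sign (Real.cos (φ + α)) ≠ SignType.sign (Real.cos (φ - α)) ↔
      |φ| ∈ Set.Ioo (Real.pi / 2 - α) (Real.pi / 2 + α) := by
  obtain ⟨ha0, ha1⟩ := hα
  have key : ∀ ψ, 0 ≤ ψ → ψ < Real.pi → ψ ≠ Real.pi / 2 - α → ψ ≠ Real.pi / 2 + α →
      (SignType.sign (Real.cos (ψ + α)) ≠ SignType.sign (Real.cos (ψ - α)) ↔
        ψ ∈ Set.Ioo (Real.pi / 2 - α) (Real.pi / 2 + α)) := by
    intro ψ h0 hpi h1 h2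
    rcases lt_or_gt_of_ne h1 with h1 | h1
    · rw [sign_pos (Real.cos_pos_of_mem_Ioo ⟨by linarith, by linarith⟩),
        sign_pos (Real.cos_pos_of_mem_Ioo ⟨by linarith, by linarith⟩)]
      simp [h1.le]
    rcases lt_or_gt_of_ne h2 with h2 | h2
    · rw [sign_neg (Real.cos_neg_of_pi_div_two_lt_of_lt (by linarith) (by linarith)),
        sign_pos (Real.cos_pos_of_mem_Ioo ⟨by linarith, by linarith⟩)]
      simp [h1, h2]
    · rw [sign_neg (Real.cos_neg_of_pi_div_two_lt_of_lt (by linarith) (by linarith)),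
        sign_neg (Real.cos_neg_of_pi_div_two_lt_of_lt (by linarith) (by linarith))]
      simp [h2.le]
  rcases le_total 0 φ with h | h
  · rw [abs_of_nonneg h] at *
    exact key φ h hφ.2 h1 h2
  · rw [abs_of_nonpos h] at *
    -- Cosine is even, so replacing `φ` by `-φ` merely swaps the two cosines.
    rw [← key (-φ) (by linarith) (by linarith [hφ.1]) h1 h2, ← Real.cos_neg (φ + α),
      ← Real.cos_neg (φ - α), ne_comm]
    ring_nf

theorem volume_real_sign_cos_ne {α : ℝ} (hα : α ∈ Set.Icc 0 (Real.pi / 2)) :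
    volume.real (Set.Ioo (-Real.pi) Real.pi ∩
      {φ | SignType.sign (Real.cos (φ + α)) ≠ SignType.sign (Real.cos (φ - α))}) = 4 * α := by
  have hpi := Real.pi_pos
  have hne : ∀ c : ℝ, ∀ᵐ φ : ℝ, |φ| ≠ c := by
    intro c
    filter_upwards [Measure.ae_ne volume c, Measure.ae_ne volume (-c)] with φ h1 h2 h
    rcases abs_choice φ with h3 | h3
    · exact h1 (h3 ▸ h)
    · exact h2 (by linarith)
  have hae : (Set.Ioo (-Real.pi) Real.pi ∩
      {φ | SignType.sign (Real.cos (φ + α)) ≠ SignType.sign (Real.cos (φ - α))} : Set ℝ) =ᵐ[volume]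
      (Set.Ioo (-(Real.pi / 2 + α)) (-(Real.pi / 2 - α)) ∪
        Set.Ioo (Real.pi / 2 - α) (Real.pi / 2 + α) : Set ℝ) := by
    rw [Filter.eventuallyEq_set]
    filter_upwards [hne (Real.pi / 2 - α), hne (Real.pi / 2 + α)] with φ h1 h2
    have hiff : φ ∈ Set.Ioo (-(Real.pi / 2 + α)) (-(Real.pi / 2 - α)) ∪
        Set.Ioo (Real.pi / 2 - α) (Real.pi / 2 + α) ↔
        |φ| ∈ Set.Ioo (Real.pi / 2 - α) (Real.pi / 2 + α) := by
      simp only [Set.mem_union, Set.mem_Ioo]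
      obtain ⟨ha0, ha1⟩ := hα
      rcases le_total 0 φ with h | h
      · rw [abs_of_nonneg h]
        constructor
        · rintro (⟨-, h3⟩ | h3)
          · linarith
          · exact h3
        · exact Or.inr
      · rw [abs_of_nonpos h]
        constructor
        · rintro (⟨h3, h4⟩ | ⟨h3, -⟩)
          · constructor <;> linarith
          · linarith
        · exact fun ⟨h3, h4⟩ => Or.inl ⟨by linarith, by linarith⟩
    rw [hiff]
    constructor
    · exact fun h => (sign_cos_ne_sign_cos_iff hα h.1 h1 h2).1 h.2
    · intro h
      have hφ : φ ∈ Set.Ioo (-Real.pi) Real.pi := abs_lt.1 (by linarith [h.2, hα.2])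
      exact ⟨hφ, (sign_cos_ne_sign_cos_iff hα hφ h1 h2).2 h⟩
  rw [measureReal_congr hae, measureReal_union ?_ measurableSet_Ioo (by simp) (by simp),
    Real.volume_real_Ioo_of_le (by linarith [hα.1]), Real.volume_real_Ioo_of_le (by linarith [hα.1])]
  · ring
  · rw [Set.disjoint_left]
    intro φ h1 h2
    linarith [h1.2, h2.1, hα.2]

theorem stdGaussian_real_sign_ne {x y : E} (hx : x ≠ 0) (hy : y ≠ 0) :
    (stdGaussian E).real {g | SignType.sign ⟪x, g⟫ ≠ SignType.sign ⟪y, g⟫} =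
      Real.arccos (⟪x, y⟫ / (‖x‖ * ‖y‖)) / Real.pi := by
  set θ := Real.arccos (⟪x, y⟫ / (‖x‖ * ‖y‖)) with hθ
  have hxn := norm_pos_iff.2 hx
  have hyn := norm_pos_iff.2 hy
  have hcos : Real.cos θ = ⟪x, y⟫ / (‖x‖ * ‖y‖) :=
    have h := abs_le.1 (abs_real_inner_div_norm_mul_norm_le_one x y)
    Real.cos_arccos h.1 h.2
  have hα : θ / 2 ∈ Set.Icc 0 (Real.pi / 2) :=
    ⟨by linarith [Real.arccos_nonneg (⟪x, y⟫ / (‖x‖ * ‖y‖))],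
      by linarith [Real.arccos_le_pi (⟪x, y⟫ / (‖x‖ * ‖y‖))]⟩
  -- Planar copies of `x, y` at angles `∓θ/2`, with the same Gram matrix. Against `(cos φ, sin φ)`
  -- they give positive multiples of `cos (φ + θ/2)` and `cos (φ - θ/2)`.
  set x' : EuclideanSpace ℝ (Fin 2) := ‖x‖ • !₂[Real.cos (θ / 2), -Real.sin (θ / 2)] with hx'
  set y' : EuclideanSpace ℝ (Fin 2) := ‖y‖ • !₂[Real.cos (θ / 2), Real.sin (θ / 2)] with hy'
  have hlaw : (stdGaussian E).map (fun g => (⟪x, g⟫, ⟪y, g⟫)) =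
      (stdGaussian (EuclideanSpace ℝ (Fin 2))).map fun g => (⟪x', g⟫, ⟪y', g⟫) := by
    refine map_inner_pair_stdGaussian_congr ?_ ?_ ?_
    · simp [hx', norm_smul, EuclideanSpace.norm_eq, Fin.sum_univ_two]
    · simp [hy', norm_smul, EuclideanSpace.norm_eq, Fin.sum_univ_two]
    · rw [hx', hy', real_inner_smul_left, real_inner_smul_right]
      simp only [PiLp.inner_apply, Fin.sum_univ_two]
      have h2 : Real.cos θ = Real.cos (θ / 2) * Real.cos (θ / 2) -
          Real.sin (θ / 2) * Real.sin (θ / 2) := by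
        rw [← Real.cos_add, add_halves]
      rw [hcos, div_eq_iff (by positivity)] at h2
      rw [h2]
      simp
      ring
  set s : Set (ℝ × ℝ) := {p | SignType.sign p.1 ≠ SignType.sign p.2} with hs
  have hsm : MeasurableSet s := (measurableSet_sign_eq_sign measurable_fst measurable_snd).compl
  set T : ℝ × ℝ → ℝ × ℝ := fun p =>
    (‖x‖ * (Real.cos (θ / 2) * p.1 - Real.sin (θ / 2) * p.2),
      ‖y‖ * (Real.cos (θ / 2) * p.1 + Real.sin (θ / 2) * p.2)) with hT
  have hTm : Measurable T := by fun_prop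
  have hlaw2 : (stdGaussian (EuclideanSpace ℝ (Fin 2))).map (fun g => (⟪x', g⟫, ⟪y', g⟫)) =
      ((gaussianReal 0 1).prod (gaussianReal 0 1)).map T := by
    rw [← map_coords_stdGaussian_two, Measure.map_map hTm (by fun_prop)]
    congr 1
    ext1 g
    simp only [hx', hy', hT, PiLp.inner_apply, Fin.sum_univ_two,
      Function.comp_apply]
    simp
    constructor <;> ring
  have hcone : ∀ r : ℝ, 0 < r → ∀ p, r • p ∈ T ⁻¹' s ↔ p ∈ T ⁻¹' s := by
    intro r hr p
    have : T (r • p) = (r * (T p).1, r * (T p).2) := by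
      simp only [hT, Prod.smul_fst, Prod.smul_snd, smul_eq_mul, Prod.mk.injEq]
      constructor <;> ring
    simp only [Set.mem_preimage, this, hs, Set.mem_ofPred_eq, sign_mul_of_pos hr]
  calc (stdGaussian E).real {g | SignType.sign ⟪x, g⟫ ≠ SignType.sign ⟪y, g⟫}
      = ((stdGaussian E).map fun g => (⟪x, g⟫, ⟪y, g⟫)).real s :=
        (map_measureReal_apply (f := fun g => (⟪x, g⟫, ⟪y, g⟫)) (by fun_prop) hsm).symm
    _ = ((gaussianReal 0 1).prod (gaussianReal 0 1)).real (T ⁻¹' s) := by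
        rw [hlaw, hlaw2, map_measureReal_apply hTm hsm]
    _ = 4 * (θ / 2) / (2 * Real.pi) := by
        rw [gaussian_prod_real_cone (hTm hsm) hcone, ← volume_real_sign_cos_ne hα]
        congr 3
        ext φ
        simp only [hT, hs, Set.mem_preimage, Set.mem_ofPred_eq, sign_mul_of_pos hxn,
          sign_mul_of_pos hyn, Real.cos_add, Real.cos_sub, mul_comm]
    _ = θ / Real.pi := by
        have := Real.pi_ne_zero
        field_simp
        ring

end Angle

/-! ### Rows of Haar-random orthogonal matrices -/

section Haar

variable {D : ℕ} {Ω : Type*} [MeasurableSpace Ω] {P : Measure Ω} [IsProbabilityMeasure P]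
  {Q : Ω → Matrix.orthogonalGroup (Fin D) ℝ}

theorem IsHaarRandom.hasLaw_orthogonalRow (hQ : IsHaarRandom Q P) (i : Fin D)
    (ρ : Measure (EuclideanSpace ℝ (Fin D))) [IsProbabilityMeasure ρ]
    (hρ : ∀ᵐ x ∂ρ, ‖x‖ = 1)
    (hinv : ∀ f : EuclideanSpace ℝ (Fin D) ≃ₗᵢ[ℝ] EuclideanSpace ℝ (Fin D), ρ.map f = ρ) :
    HasLaw (fun ω => orthogonalRow i (Q ω)) ρ P := by
  obtain ⟨hm, hH⟩ := hQ
  have := Measure.isProbabilityMeasure_map hm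
  have hrow := (continuous_orthogonalRow (D := D) i).measurable
  refine ⟨hrow.comp_aemeasurable hm, ?_⟩
  have h := AEMeasurable.map_map_of_aemeasurable hrow.aemeasurable hm
  exact h.symm.trans (map_orthogonalRow_eq _ i ρ hρ hinv)

theorem IsHaarRandom.hasLaw_uniformSphere (hQ : IsHaarRandom Q P) (i : Fin D) :
    HasLaw (fun ω => orthogonalRow i (Q ω)) (uniformSphere D) P :=
  have := isProbabilityMeasure_uniformSphere i.pos
  hQ.hasLaw_orthogonalRow i _ ae_norm_uniformSphere map_uniformSphere

/-- Transfers events about a single row to a normalized Gaussian vector, by uniqueness of the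
invariant law. -/
theorem IsHaarRandom.measureReal_orthogonalRow_preimage (hQ : IsHaarRandom Q P) (i : Fin D)
    {s : Set (EuclideanSpace ℝ (Fin D))} (hs : MeasurableSet s) :
    P.real {ω | orthogonalRow i (Q ω) ∈ s} =
      (stdGaussian (EuclideanSpace ℝ (Fin D))).real {g | ‖g‖⁻¹ • g ∈ s} := by
  have h := hQ.hasLaw_orthogonalRow i _ (ae_norm_gaussianSphere i.pos) map_gaussianSphere
  have h1 : (gaussianSphere D).real s = P.real {ω | orthogonalRow i (Q ω) ∈ s} := by
    rw [← h.map_eq, map_measureReal_apply_of_aemeasurable h.aemeasurable hs]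
    rfl
  rw [← h1, gaussianSphere, map_measureReal_apply (by fun_prop) hs]
  rfl

theorem signHash_eq_sign_inner (U : Matrix.orthogonalGroup (Fin D) ℝ)
    (x : EuclideanSpace ℝ (Fin D)) (i : Fin D) :
    signHash U.1 x i = SignType.sign ⟪orthogonalRow i U, x⟫ := by
  rw [signHash, EuclideanSpace.inner_eq_star_dotProduct, dotProduct_comm]
  rfl

theorem IsHaarRandom.measureReal_signHash_eq (hQ : IsHaarRandom Q P) (i : Fin D)
    {x y : EuclideanSpace ℝ (Fin D)} (hx : x ≠ 0) (hy : y ≠ 0) :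
    P.real {ω | signHash (Q ω).1 x i = signHash (Q ω).1 y i} =
      1 - Real.arccos (cosSim x y) / Real.pi := by
  set s : Set (EuclideanSpace ℝ (Fin D)) :=
    {v | SignType.sign ⟪x, v⟫ = SignType.sign ⟪y, v⟫} with hs
  have hsm : MeasurableSet s := measurableSet_sign_eq_sign (by fun_prop) (by fun_prop)
  have h1 : {ω | signHash (Q ω).1 x i = signHash (Q ω).1 y i} =
      {ω | orthogonalRow i (Q ω) ∈ s} := by
    ext ω
    simp only [hs, Set.mem_ofPred_eq, signHash_eq_sign_inner, real_inner_comm]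
  have h2 : {g : EuclideanSpace ℝ (Fin D) | ‖g‖⁻¹ • g ∈ s} = s := by
    ext g
    -- The convention `0⁻¹ = 0` keeps `g = 0` fixed, so scale invariance holds everywhere, not just
    -- almost everywhere.
    rcases eq_or_ne g 0 with rfl | hg
    · simp
    · simp only [hs, Set.mem_ofPred_eq, real_inner_smul_right,
        sign_mul_of_pos (inv_pos.2 (norm_pos_iff.2 hg))]
  have h3 := stdGaussian_real_sign_ne hx hy
  have h4 : {g | SignType.sign ⟪x, g⟫ ≠ SignType.sign ⟪y, g⟫} = sᶜ := rfl
  rw [h4, probReal_compl_eq_one_sub hsm] at h3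
  rw [h1, hQ.measureReal_orthogonalRow_preimage i hsm, h2, cosSim]
  linarith

theorem rotatedVariance_eq (U : Matrix.orthogonalGroup (Fin D) ℝ) (S : Matrix (Fin D) (Fin D) ℝ)
    (i : Fin D) :
    rotatedVariance U.1 S i = (orthogonalRow i U).ofLp ⬝ᵥ (S *ᵥ (orthogonalRow i U).ofLp) := rfl

theorem IsHaarRandom.rotatedVariance_tail (hQ : IsHaarRandom Q P)
    {S : Matrix (Fin D) (Fin D) ℝ} (hS : S.PosSemidef) (i : Fin D) {t : ℝ} (ht : 0 < t)
    (hts : t ≤ opNorm S) :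
    P.real {ω | t < |rotatedVariance (Q ω).1 S i - S.trace / D|} ≤
      2 * Real.exp (-(D * t ^ 2 / (16 * opNorm S ^ 2))) := by
  -- Zero is excluded because at `g = 0` the homogeneous Gaussian event reads `0 < 0` while the
  -- normalized one may hold; rows, being unit vectors, are unaffected.
  set s : Set (EuclideanSpace ℝ (Fin D)) :=
    {v | v ≠ 0 ∧ t < |v.ofLp ⬝ᵥ (S *ᵥ v.ofLp) - S.trace / D|} with hs
  have hq : Continuous fun v : EuclideanSpace ℝ (Fin D) => v.ofLp ⬝ᵥ (S *ᵥ v.ofLp) :=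
    (PiLp.continuous_ofLp 2 _).dotProduct
      (continuous_const.matrix_mulVec (PiLp.continuous_ofLp 2 _))
  have hsm : MeasurableSet s :=
    (measurableSet_singleton (0 : EuclideanSpace ℝ (Fin D))).compl.inter
      (measurableSet_lt measurable_const (hq.sub continuous_const).abs.measurable)
  have h1 : {ω | t < |rotatedVariance (Q ω).1 S i - S.trace / D|} =
      {ω | orthogonalRow i (Q ω) ∈ s} := by
    ext ω
    have hne : orthogonalRow i (Q ω) ≠ 0 := by
      rw [← norm_ne_zero_iff, norm_orthogonalRow]
      exact one_ne_zero
    simp only [hs, Set.mem_ofPred_eq, rotatedVariance_eq, ne_eq, hne, not_false_eq_true, true_and]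
  rw [h1, hQ.measureReal_orthogonalRow_preimage i hsm]
  refine (measureReal_mono ?_).trans (stdGaussian_quadratic_tail hS ht hts)
  rintro g ⟨hg, h⟩
  have hg0 : 0 < ‖g‖ := by
    rw [norm_pos_iff]
    rintro rfl
    simp at hg
  have h3 : (‖g‖⁻¹ • g).ofLp ⬝ᵥ (S *ᵥ (‖g‖⁻¹ • g).ofLp) - S.trace / D =
      (g.ofLp ⬝ᵥ (S *ᵥ g.ofLp) - S.trace / D * ‖g‖ ^ 2) / ‖g‖ ^ 2 := by
    rw [WithLp.ofLp_smul, Matrix.mulVec_smul, smul_dotProduct, dotProduct_smul, smul_eq_mul,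
      smul_eq_mul]
    field_simp
  rw [h3, abs_div, abs_of_pos (pow_pos hg0 2), lt_div_iff₀ (pow_pos hg0 2)] at h
  exact h

theorem abs_rotatedVariance_sub_le {S : Matrix (Fin D) (Fin D) ℝ} (hS : S.PosSemidef)
    (U : Matrix.orthogonalGroup (Fin D) ℝ) (i : Fin D) :
    |rotatedVariance U.1 S i - S.trace / D| ≤ opNorm S := by
  have h1 := dotProduct_mulVec_mem_Icc hS (norm_orthogonalRow i U)
  have h2 := trace_div_mem_Icc hS
  rw [← rotatedVariance_eq] at h1
  exact abs_sub_le_of_nonneg_of_le h1.1 h1.2 h2.1 h2.2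

theorem IsHaarRandom.iSup_rotatedVariance_le (hQ : IsHaarRandom Q P)
    {S : Matrix (Fin D) (Fin D) ℝ} (hS : S.PosSemidef) (hD : 2 ≤ D) {c : ℝ} (hc : 0 < c) :
    1 - (D : ℝ) ^ (-c) ≤
      P.real {ω | (⨆ i : Fin D, |rotatedVariance (Q ω).1 S i - S.trace / D|) ≤
        4 * √(c + 2) * opNorm S * √(Real.log D / D)} := by
  have hDne : Nonempty (Fin D) := ⟨⟨0, by lia⟩⟩
  have hD0 : (0 : ℝ) < D := by positivity
  have hD2 : (2 : ℝ) ≤ D := by exact_mod_cast hD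
  have hlog : 0 < Real.log D := Real.log_pos (by linarith)
  set t := 4 * √(c + 2) * opNorm S * √(Real.log D / D) with ht
  -- The tail bound needs `t ≤ opNorm S`. For larger `t` the deviation bound is deterministic, both
  -- quantities lying in `[0, opNorm S]`.
  rcases le_or_gt (opNorm S) t with hts | hts
  · have : {ω | (⨆ i : Fin D, |rotatedVariance (Q ω).1 S i - S.trace / D|) ≤ t} = Set.univ :=
      Set.eq_univ_of_forall fun ω =>
        ciSup_le fun i => (abs_rotatedVariance_sub_le hS (Q ω) i).trans hts
    rw [this, probReal_univ]
    linarith [Real.rpow_nonneg hD0.le (-c)]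
  have hS0 : 0 < opNorm S := by
    rcases (norm_nonneg (Matrix.toEuclideanCLM (𝕜 := ℝ) S)).eq_or_lt with h | h
    · have h' : opNorm S = 0 := h.symm
      rw [ht, h'] at hts
      simp at hts
    · exact h
  have htpos : 0 < t := by positivity
  -- The constant `4 √(c + 2)` makes each row fail with probability at most `2 D^(-(c+2))`. One
  -- spare factor `D` pays for the union bound, the other for the `2`, as `D ≥ 2`.
  have hexp : D * t ^ 2 / (16 * opNorm S ^ 2) = (c + 2) * Real.log D := by
    rw [ht, mul_pow, mul_pow, mul_pow, Real.sq_sqrt (by positivity), Real.sq_sqrt (by positivity)]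
    field_simp
    ring
  have hunion : P.real (⋃ i : Fin D, {ω | t < |rotatedVariance (Q ω).1 S i - S.trace / D|}) ≤
      (D : ℝ) ^ (-c) := by
    calc _ ≤ ∑ i : Fin D, P.real {ω | t < |rotatedVariance (Q ω).1 S i - S.trace / D|} :=
          measureReal_iUnion_fintype_le _
      _ ≤ ∑ _i : Fin D, 2 * (D : ℝ) ^ (-(c + 2)) := by
          refine Finset.sum_le_sum fun i _ => ?_
          refine (hQ.rotatedVariance_tail hS i htpos hts.le).trans_eq ?_
          rw [hexp, Real.rpow_def_of_pos hD0]
          ring_nf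
      _ = 2 * D * (D : ℝ) ^ (-(c + 2)) := by
          rw [Finset.sum_const, Finset.card_univ, Fintype.card_fin, nsmul_eq_mul]
          ring
      _ ≤ D ^ 2 * (D : ℝ) ^ (-(c + 2)) := by
          gcongr
          nlinarith
      _ = (D : ℝ) ^ (-c) := by
          rw [← Real.rpow_natCast, ← Real.rpow_add hD0]
          congr 1
          push_cast
          ring
  have hcover : (Set.univ : Set Ω) ⊆
      {ω | (⨆ i : Fin D, |rotatedVariance (Q ω).1 S i - S.trace / D|) ≤ t} ∪
        ⋃ i : Fin D, {ω | t < |rotatedVariance (Q ω).1 S i - S.trace / D|} := by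
    intro ω _
    by_cases h : ∃ i : Fin D, t < |rotatedVariance (Q ω).1 S i - S.trace / D|
    · exact Or.inr (Set.mem_iUnion.2 h)
    · exact Or.inl (ciSup_le (not_exists.1 h · |> not_lt.1))
  have := (measureReal_mono (μ := P) hcover).trans (measureReal_union_le _ _)
  rw [probReal_univ] at this
  linarith

end Haar

theorem mainTheorem3 :
    (∀ (D : ℕ) (Ω : Type*) [MeasurableSpace Ω] (P : Measure Ω) [IsProbabilityMeasure P]
      (Q : Ω → Matrix.orthogonalGroup (Fin D) ℝ), IsHaarRandom Q P → ∀ i : Fin D,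
        IsRandomHyperplaneHash (fun ω x => signHash (Q ω).1 x i) P ∧
        ∀ x y : EuclideanSpace ℝ (Fin D), x ≠ 0 → y ≠ 0 →
          P.real {ω | signHash (Q ω).1 x i = signHash (Q ω).1 y i} =
            1 - Real.arccos (cosSim x y) / Real.pi) ∧
    (∀ c : ℝ, 0 < c → ∃ C : ℝ, 0 < C ∧
      ∀ (D : ℕ), 1 ≤ D → ∀ (Ω : Type*) [MeasurableSpace Ω] (P : Measure Ω) [IsProbabilityMeasure P]
        (Q : Ω → Matrix.orthogonalGroup (Fin D) ℝ), IsHaarRandom Q P →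
        ∀ S : Matrix (Fin D) (Fin D) ℝ, S.PosSemidef →
          1 - (D : ℝ) ^ (-c) ≤
            P.real {ω | (⨆ i : Fin D, |rotatedVariance (Q ω).1 S i - S.trace / D|) ≤
              C * opNorm S * Real.sqrt (Real.log D / D)}) := by
  refine ⟨fun D Ω _ P _ Q hQ i => ⟨⟨fun ω => orthogonalRow i (Q ω), hQ.hasLaw_uniformSphere i,
    fun ω x => signHash_eq_sign_inner (Q ω) x i⟩, fun x y hx hy =>
      hQ.measureReal_signHash_eq i hx hy⟩, fun c hc => ⟨4 * √(c + 2), by positivity, ?_⟩⟩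
  intro D hD Ω _ P _ Q hQ S hS
  -- For `D = 1` the required probability is `1 - 1 = 0`.
  rcases hD.eq_or_lt with rfl | hD
  · simp
  · exact hQ.iSup_rotatedVariance_le hS hD hc
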